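/- Let $\mathcal{C}_0$ be a Barr exact category that has coequalisers of reflexive pairs and enough projectives with respect to regular epimorphisms (every object $B$ admits a regular epimorphism $P\to B$ whose domain $P$ has the lifting property against all regular epimorphisms). For a category $\mathcal{Y}$ with a class $\mathcal{E}$ of morphisms, called extensions, an $\mathcal{E}$-double extension is a commutative square $(\alpha_\top,\alpha_\bot)\colon f_A\to f_B$ whose four sides, the two projections of the pullback $A_\bot\times_{B_\bot}B_\top$, and the comparison map $A_\top\to A_\bot\times_{B_\bot}B_\top$ all lie in $\mathcal{E}$. Let $\mathcal{E}_1$ be the class of regular epimorphisms of $\mathcal{C}_0$; inductively let $\mathcal{E}_{k+1}$ be the class of those morphisms of the category $\mathsf{Arr}^k(\mathcal{C}_0)$ of $k$-fold arrows that are $\mathcal{E}_k$-double extensions. For $k\ge 1$ let $\mathcal{C}_k=\mathsf{Ext}(\mathcal{C}_{k-1})$ be the full subcategory of $\mathsf{Arr}^k(\mathcal{C}_0)$ on the elements of $\mathcal{E}_k$. Given a full replete reflective subcategory of $\mathcal{Y}$, with reflector $L$ and unit $\eta$ having components in $\mathcal{E}$, the reflection is strongly $\mathcal{E}$-Birkhoff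 if for each extension $f\colon A\to B$ the reflection square $(\eta_A,\eta_B)\colon f\to L(f)$ is an $\mathcal{E}$-double extension. An extension is a trivial covering if its reflection square is a pullback, and a covering if its pullback along some extension is a trivial covering; $\mathsf{Cov}(\mathcal{Y})$ is the full subcategory of $\mathsf{Ext}(\mathcal{Y})$ on the coverings. Let $n\ge 0$ and suppose that for each $0\le k\le n$ a full replete subcategory $\mathcal{B}_k$ of $\mathcal{C}_k$ is given, which is reflective with reflector $F_k$ and unit $\eta^k$ having components in $\mathcal{E}_{k+1}$, is strongly $\mathcal{E}_{k+1}$-Birkhoff, and, when $k\ge 1$, satisfies $\mathcal{B}_k=\mathsf{Cov}(\mathcal{C}_{k-1})$. Then the category $\mathcal{B}_{n+1}=\mathsf{Cov}(\mathcal{C}_n)$ of coverings with respect to $F_n$ is reflective in $\mathcal{C}_{n+1}=\mathsf{Ext}(\mathcal{C}_n)$. Moreover, let $f\colon A\to B$ be an extension in $\mathcal{C}_n$. There is an extension $p\colon P\to B$ in $\mathcal{C}_n$ with $P$ projective with respect to $\mathcal{E}_{n+1}$; and for every such $p$, with pullback projections $\pi_P\colon P\times_BA\to P$ and $\pi_A\colon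 P\times_BA\to A$, and with $\hat f\colon \mathrm{Eq}(\pi_A)\to \mathrm{Eq}(p)$ the induced morphism between the kernel pairs, let $\mathrm{Triv}(\pi_P)$ and $\mathrm{Triv}(\hat f)$ be the pullbacks of $F_n(\pi_P)$ and $F_n(\hat f)$ along the units $\eta^n_P$ and $\eta^n_{\mathrm{Eq}(p)}$, let $\tau\colon P\times_BA\to\operatorname{dom}\mathrm{Triv}(\pi_P)$ be the comparison map, and let $\pi_1,\pi_2\colon \operatorname{dom}\mathrm{Triv}(\hat f)\rightrightarrows\operatorname{dom}\mathrm{Triv}(\pi_P)$ be induced by the kernel pair projections (all taken in $\mathcal{C}_n$; for at least one $p$ all these objects exist, and for any given $p$ the following holds for every choice of them). Then $\pi_1,\pi_2$ have a coequaliser $r$ in $\mathcal{C}_n$, with codomain $C_f$ say, and there are morphisms $h\colon A\to C_f$ and $g\colon C_f\to B$ with $r\tau=h\pi_A$, $gr=p\,\mathrm{Triv}(\pi_P)$ and $gh=f$, such that $g$ is a covering and $(h,1_B)\colon f\to g$ is universal among the morphisms in $\mathcal{C}_{n+1}$ from $f$ to coverings. -/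

import Mathlib

open CategoryTheory CategoryTheory.Limits

universe v u w w'

namespace HigherCoverings

section Generic

variable {Y : Type w} [Category.{w'} Y]

/-- The commutative square with top side `αt : A₁ ⟶ B₁`, left side `fA : A₁ ⟶ A₀`, right side
`fB : B₁ ⟶ B₀` and bottom side `αb : A₀ ⟶ B₀` is an `E`-double extension: its four sides, the two
projections of the pullback of `αb` and `fB`, and the comparison map `A₁ ⟶ A₀ ×_{B₀} B₁` all
belong to the class `E`. -/
structure IsDoubleExtension (E : MorphismProperty Y) {A₁ B₁ A₀ B₀ : Y}
    (αt : A₁ ⟶ B₁) (fA : A₁ ⟶ A₀) (fB : B₁ ⟶ B₀) (αb : A₀ ⟶ B₀) : Prop where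
  comm : αt ≫ fB = fA ≫ αb
  top_mem : E αt
  left_mem : E fA
  right_mem : E fB
  bot_mem : E αb
  comparison : ∃ (P : Y) (π₁ : P ⟶ A₀) (π₂ : P ⟶ B₁) (p : A₁ ⟶ P),
    IsPullback π₁ π₂ αb fB ∧ p ≫ π₁ = fA ∧ p ≫ π₂ = αt ∧ E π₁ ∧ E π₂ ∧ E p

/-- The `E`-double extensions, as a class of morphisms of the arrow category. -/
def doubleExtensions (E : MorphismProperty Y) : MorphismProperty (Arrow Y) :=
  fun f g α => IsDoubleExtension E α.left f.hom g.hom α.right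

/-- `P` is projective with respect to the morphisms of the class `E`. -/
def IsProjectiveFor (E : MorphismProperty Y) (P : Y) : Prop :=
  ∀ ⦃A B : Y⦄ (e : A ⟶ B), E e → ∀ b : P ⟶ B, ∃ a : P ⟶ A, a ≫ e = b

/-- A full replete `E`-reflective subcategory of `Y`, with a chosen reflector `L`: the components
of the unit of the adjunction belong to `E`. -/
structure GaloisStructure (E : MorphismProperty Y) where
  /-- the objects of the subcategory -/
  X : ObjectProperty Y
  replete : X.IsClosedUnderIsomorphisms
  /-- the reflector -/
  L : Y ⥤ X.FullSubcategory
  /-- the reflector is left adjoint to the inclusion -/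
  adj : L ⊣ X.ι
  unit_mem : ∀ A : Y, E (adj.unit.app A)

namespace GaloisStructure

variable {E : MorphismProperty Y} (Γ : GaloisStructure E)

/-- The reflection of an object, seen in `Y`. -/
abbrev refl (A : Y) : Y := (Γ.L.obj A).obj

/-- The reflection of a morphism, seen in `Y`. -/
abbrev reflMap {A B : Y} (f : A ⟶ B) : Γ.refl A ⟶ Γ.refl B := Γ.X.ι.map (Γ.L.map f)

/-- The unit of the reflection. -/
abbrev η (A : Y) : A ⟶ Γ.refl A := Γ.adj.unit.app A

/-- The reflection square at every extension is a double extension. -/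
def StronglyBirkhoff : Prop :=
  ∀ ⦃A B : Y⦄ (f : A ⟶ B), E f → IsDoubleExtension E (Γ.η A) f (Γ.reflMap f) (Γ.η B)

/-- Trivial coverings: extensions whose reflection square is a pullback. -/
def trivialCovering : MorphismProperty Y :=
  fun A B t => E t ∧ IsPullback (Γ.η A) t (Γ.reflMap t) (Γ.η B)

/-- Coverings: extensions `c` such that the pullback of `c` along some extension `e` is a trivial
covering. -/
def covering : MorphismProperty Y :=
  fun A B c => E c ∧ ∃ (S T : Y) (e : S ⟶ B) (t : T ⟶ S) (a : T ⟶ A),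
    E e ∧ IsPullback a t c e ∧ Γ.trivialCovering t

/-- The trivialisation of `f : A ⟶ B`: the pullback of the reflection of `f` along the unit at
`B`, with the comparison map from `A`. -/
structure Trivialisation {A B : Y} (f : A ⟶ B) where
  /-- the domain of the trivialisation -/
  obj : Y
  /-- the trivialisation -/
  map : obj ⟶ B
  /-- the other projection of the pullback -/
  toRefl : obj ⟶ Γ.refl A
  isPullback : IsPullback toRefl map (Γ.reflMap f) (Γ.η B)
  /-- the comparison map -/
  τ : A ⟶ obj
  τ_map : τ ≫ map = f
  τ_toRefl : τ ≫ toRefl = Γ.η A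

/-- For `f : A ⟶ B`: a projective presentation `p : P ⟶ B`, the pullback `πP : X ⟶ P` of `f` along
`p`, the kernel pairs of `πA : X ⟶ A` and of `p`, the induced `fhat` between them, the
trivialisations of `fhat` and of `πP`, and the two morphisms `π₁`, `π₂` between the domains of
these that are induced by the projections of the kernel pairs. -/
structure TrivialisedPresentation {A B : Y} (f : A ⟶ B) where
  /-- the projective object -/
  P : Y
  /-- the presentation -/
  p : P ⟶ B
  p_mem : E p
  projective : IsProjectiveFor E P
  /-- the pullback of `f` and `p` -/
  X : Y
  /-- the projection to `A` -/
  πA : X ⟶ A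
  /-- the projection to `P` -/
  πP : X ⟶ P
  isPullback : IsPullback πA πP f p
  /-- the kernel pair of `πA` -/
  R : Y
  /-- its first projection -/
  d₁ : R ⟶ X
  /-- its second projection -/
  d₂ : R ⟶ X
  isKernelPair_πA : IsKernelPair πA d₁ d₂
  /-- the kernel pair of `p` -/
  Q : Y
  /-- its first projection -/
  q₁ : Q ⟶ P
  /-- its second projection -/
  q₂ : Q ⟶ P
  isKernelPair_p : IsKernelPair p q₁ q₂
  /-- the induced morphism between the kernel pairs -/
  fhat : R ⟶ Q
  fhat_q₁ : fhat ≫ q₁ = d₁ ≫ πP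
  fhat_q₂ : fhat ≫ q₂ = d₂ ≫ πP
  /-- the trivialisation of `πP` -/
  trivX : Γ.Trivialisation πP
  /-- the trivialisation of `fhat` -/
  trivR : Γ.Trivialisation fhat
  /-- the morphism induced by the first projections -/
  π₁ : trivR.obj ⟶ trivX.obj
  /-- the morphism induced by the second projections -/
  π₂ : trivR.obj ⟶ trivX.obj
  π₁_map : π₁ ≫ trivX.map = trivR.map ≫ q₁
  π₁_toRefl : π₁ ≫ trivX.toRefl = trivR.toRefl ≫ Γ.reflMap d₁
  π₂_map : π₂ ≫ trivX.map = trivR.map ≫ q₂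
  π₂_toRefl : π₂ ≫ trivX.toRefl = trivR.toRefl ≫ Γ.reflMap d₂

/-- `(h, 𝟙 B)` is a morphism from the extension `f : A ⟶ B` to the covering `g : A' ⟶ B`, and it
is universal among the morphisms from `f` to coverings. -/
structure IsCoveringReflection {A A' B : Y} (f : A ⟶ B) (h : A ⟶ A') (g : A' ⟶ B) : Prop where
  fac : h ≫ g = f
  covering : Γ.covering g
  universal : ∀ ⦃D D' : Y⦄ (c : D ⟶ D'), Γ.covering c → ∀ (a : A ⟶ D) (b : B ⟶ D'),
    a ≫ c = f ≫ b → ∃! x : A' ⟶ D, h ≫ x = a ∧ x ≫ c = g ≫ b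

end GaloisStructure

end Generic

/-- Barr exact categories: regular categories in which every internal equivalence relation is a
kernel pair. -/
class BarrExact (C : Type w) [Category.{w'} C] : Prop extends Regular C where
  effective : ∀ ⦃R A : C⦄ (p₁ p₂ : R ⟶ A), IsEquivalenceRelation p₁ p₂ →
    ∃ (B : C) (q : A ⟶ B), IsKernelPair q p₁ p₂

/-- Enough projectives, with respect to regular epimorphisms. -/
class EnoughRegularProjectives (C : Type w) [Category.{w'} C] : Prop where
  presentation : ∀ B : C, ∃ (P : C) (p : P ⟶ B),
    IsRegularEpi p ∧ IsProjectiveFor (MorphismProperty.regularEpi C) P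

section Tower

variable (C : Type (max u v)) [Category.{v} C]

/-- The category `Arrⁿ(C)` of `n`-fold arrows of `C`. -/
def arr : ℕ → Cat.{v, max u v}
  | 0 => Cat.of C
  | n + 1 => Cat.of (Arrow (arr n))

/-- The class of `(n+1)`-fold extensions, as a class of morphisms of `Arrⁿ(C)`: regular
epimorphisms for `n = 0`, and double extensions of `n`-fold extensions for `n > 0`. -/
def ext : (n : ℕ) → MorphismProperty (arr.{v, u} C n)
  | 0 => MorphismProperty.regularEpi C
  | n + 1 => doubleExtensions (ext n)

/-- The `n`-fold extensions, as objects of `Arrⁿ(C)`. Every object of `C` is a `0`-fold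
extension. -/
def isExt : (n : ℕ) → ObjectProperty (arr.{v, u} C n)
  | 0 => fun _ => True
  | n + 1 => fun f : Arrow (arr.{v, u} C n) => ext C n f.hom

/-- The category `Cₙ = Extⁿ(C)` of `n`-fold extensions. -/
abbrev Level (n : ℕ) : Type (max u v) := (isExt.{v, u} C n).FullSubcategory

/-- The class of extensions in `Cₙ`: the `(n+1)`-fold extensions. -/
def levelExt (n : ℕ) : MorphismProperty (Level.{v, u} C n) :=
  (ext.{v, u} C n).inverseImage (isExt.{v, u} C n).ι

variable {C}

theorem isExt_source : ∀ {n : ℕ} {A B : arr.{v, u} C n} (f : A ⟶ B),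
    ext.{v, u} C n f → isExt.{v, u} C n A
  | 0, _, _, _, _ => trivial
  | _ + 1, _, _, _, h => h.left_mem

theorem isExt_target : ∀ {n : ℕ} {A B : arr.{v, u} C n} (f : A ⟶ B),
    ext.{v, u} C n f → isExt.{v, u} C n B
  | 0, _, _, _, _ => trivial
  | _ + 1, _, _, _, h => h.right_mem

namespace Level

variable {n : ℕ}

/-- The morphism of `n`-fold arrows underlying an object of `Cₙ₊₁`. -/
abbrev toArrow (F : Level.{v, u} C (n + 1)) : Arrow (arr.{v, u} C n) := F.obj

/-- The domain of an `(n+1)`-fold extension, as an object of `Cₙ`. -/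
def dom (F : Level.{v, u} C (n + 1)) : Level.{v, u} C n :=
  ⟨F.toArrow.left, isExt_source F.toArrow.hom F.property⟩

/-- The codomain of an `(n+1)`-fold extension, as an object of `Cₙ`. -/
def cod (F : Level.{v, u} C (n + 1)) : Level.{v, u} C n :=
  ⟨F.toArrow.right, isExt_target F.toArrow.hom F.property⟩

/-- An object of `Cₙ₊₁`, seen as a morphism of `Cₙ`. -/
def toHom (F : Level.{v, u} C (n + 1)) : F.dom ⟶ F.cod :=
  ObjectProperty.homMk F.toArrow.hom

end Level

/-- The coverings of a Galois structure on `Cₙ`, as objects of `Cₙ₊₁ = Ext(Cₙ)`. The associated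
full subcategory is `Cov(Cₙ)`. -/
def Cov {n : ℕ} (Γ : GaloisStructure (levelExt.{v, u} C n)) :
    ObjectProperty (Level.{v, u} C (n + 1)) :=
  fun F => Γ.covering F.toHom

variable (C)

/-- A tower of strongly Birkhoff Galois structures `Γ₀, …, Γₙ` over `C`: the ambient category of
`Γₖ` is `Cₖ` with the `(k+1)`-fold extensions, and the reflective subcategory of `Γₖ₊₁` is that of
the `Γₖ`-coverings. -/
structure GaloisTower (n : ℕ) where
  /-- the Galois structure at level `k` -/
  Γ : ∀ k : ℕ, k ≤ n → GaloisStructure (levelExt.{v, u} C k)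
  stronglyBirkhoff : ∀ (k : ℕ) (hk : k ≤ n), (Γ k hk).StronglyBirkhoff
  eq_cov : ∀ (k : ℕ) (hk : k + 1 ≤ n),
    (Γ (k + 1) hk).X = Cov (Γ k (Nat.le_of_succ_le hk))

variable {C}

/-- The Galois structure at the highest level of the tower. -/
abbrev GaloisTower.last {n : ℕ} (T : GaloisTower.{v, u} C n) :
    GaloisStructure (levelExt.{v, u} C n) :=
  T.Γ n le_rfl

end Tower

end HigherCoverings

/-!
Seeing the objects of `Cₖ` as `k`-cubes in `C`, every component of the unit `ηᵏ` is an isomorphism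
at all vertices but the initial one. This is proved by induction along the tower, together with the
construction of the covering reflection. If it holds at level `k`, the comparison map
`τ : X ⟶ Triv(πP)` is invertible away from the initial vertex as well, so its pushout along
`πA : X ⟶ A` can be computed there, where it is a pushout of regular epimorphisms of `C`: the
coequaliser of the image under `τ` of the kernel pair of `πA`.

Let `r : Triv(πP) ⟶ A'` and `h : A ⟶ A'` be the pushout, and `g : A' ⟶ B` the morphism that
`Triv(πP) ⟶ P ⟶ B` and `f` induce on it. The pushout property makes `r` the coequaliser of `π₁` and
`π₂`, and the comparison from `Triv(πP)` to the pullback of `g` along `p` is an extension. A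
quotient of a trivial covering is a trivial covering, so `g` is a covering. Since `P` is projective,
a morphism from `f` to a covering, restricted along `p`, factors through a trivial covering, hence
through `Triv(πP)`, and so through the pushout. The unit `ηᵏ⁺¹` is isomorphic to the resulting
reflection `(h, 1)`, which is invertible away from the initial vertex because `h` is a pushout
of `τ`.
-/

namespace HigherCoverings

section Arrows

variable {Y : Type w} [Category.{w'} Y]

theorem isPushout_of_isPushout_left_right {X T A D : Arrow Y} {τ : X ⟶ T} {π : X ⟶ A} {r : T ⟶ D}
    {h : A ⟶ D} (hl : IsPushout τ.left π.left r.left h.left)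
    (hr : IsPushout τ.right π.right r.right h.right) : IsPushout τ π r h := by
  refine IsPushout.mk' (Arrow.hom_ext _ _ hl.w hr.w) (fun Z φ φ' h₁ h₂ => ?_) fun Z a b hab => ?_
  · exact Arrow.hom_ext _ _
      (hl.hom_ext (congrArg CommaMorphism.left h₁) (congrArg CommaMorphism.left h₂))
      (hr.hom_ext (congrArg CommaMorphism.right h₁) (congrArg CommaMorphism.right h₂))
  · have hab₁ : τ.left ≫ a.left = π.left ≫ b.left := congrArg CommaMorphism.left hab
    have hab₀ : τ.right ≫ a.right = π.right ≫ b.right := congrArg CommaMorphism.right hab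
    refine ⟨Arrow.homMk (hl.desc a.left b.left hab₁) (hr.desc a.right b.right hab₀) ?_,
      Arrow.hom_ext _ _ (hl.inl_desc _ _ _) (hr.inl_desc _ _ _),
      Arrow.hom_ext _ _ (hl.inr_desc _ _ _) (hr.inr_desc _ _ _)⟩
    apply hl.hom_ext
    · simp
    · simp

variable {J : Type*} [Category* J] [HasLimitsOfShape J Y]

instance preservesLimitsOfShape_arrow_leftFunc :
    PreservesLimitsOfShape J (Arrow.leftFunc : Arrow Y ⥤ Y) where
  preservesLimit := preservesLimit_of_preserves_limit_cone
    (Comma.coneOfPreservesIsLimit _ (limit.isLimit _) (limit.isLimit _)) (limit.isLimit _)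

instance preservesLimitsOfShape_arrow_rightFunc :
    PreservesLimitsOfShape J (Arrow.rightFunc : Arrow Y ⥤ Y) where
  preservesLimit := preservesLimit_of_preserves_limit_cone
    (Comma.coneOfPreservesIsLimit _ (limit.isLimit _) (limit.isLimit _)) (limit.isLimit _)

end Arrows

section ExtensionClasses

variable {Y : Type w} [Category.{w'} Y]

theorem IsProjectiveFor.arrow {E : MorphismProperty Y} {Q : Arrow Y} (h₁ : IsProjectiveFor E Q.left)
    (h₀ : IsProjectiveFor E Q.right) : IsProjectiveFor (doubleExtensions E) Q := by
  intro A B α hα γ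
  obtain ⟨δb, hδb⟩ := h₀ α.right hα.bot_mem γ.right
  obtain ⟨M, π₁, π₂, p, hM, hp₁, hp₂, -, -, hp⟩ := hα.comparison
  obtain ⟨δt, hδt⟩ := h₁ p hp
    (hM.lift (Q.hom ≫ δb) γ.left (by rw [Category.assoc, hδb, Arrow.w γ]))
  refine ⟨Arrow.homMk δt δb ?_, Arrow.hom_ext _ _ ?_ hδb⟩
  · rw [← hp₁, reassoc_of% hδt, hM.lift_fst]
  · change δt ≫ α.left = γ.left
    rw [← hp₂, reassoc_of% hδt, hM.lift_snd]

/-- `E` behaves like the class of extensions between the objects satisfying `O`: a class of regular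
epimorphisms between such objects with the usual stability properties, and with enough projectives.
Morphisms between objects that do not satisfy `O` never belong to `E`; the absolute case is
`O = ⊤`. -/
class IsExtensionClass (E : MorphismProperty Y) (O : outParam (ObjectProperty Y)) : Prop
    extends E.IsStableUnderComposition, E.HasOfPrecompProperty E where
  source : ∀ ⦃A B : Y⦄ {f : A ⟶ B}, E f → O A
  target : ∀ ⦃A B : Y⦄ {f : A ⟶ B}, E f → O B
  mem_of_isIso : ∀ ⦃A B : Y⦄ (f : A ⟶ B) [IsIso f], O A → E f
  mem_of_isPullback : ∀ ⦃P A B D : Y⦄ {fst : P ⟶ A} {snd : P ⟶ D} {f : A ⟶ B} {g : D ⟶ B},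
    IsPullback fst snd f g → E f → O D → E snd
  isRegularEpi : ∀ ⦃A B : Y⦄ {f : A ⟶ B}, E f → IsRegularEpi f
  exists_projective : ∀ B : Y, O B → ∃ (P : Y) (p : P ⟶ B), E p ∧ IsProjectiveFor E P

namespace IsExtensionClass

variable {E : MorphismProperty Y} {O : ObjectProperty Y} [hE : IsExtensionClass E O]

include hE

theorem epi {A B : Y} {f : A ⟶ B} (hf : E f) : Epi f :=
  have := isRegularEpi hf
  inferInstance

theorem isIso_of_mono {A B : Y} {f : A ⟶ B} [Mono f] (hf : E f) : IsIso f :=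
  have := isRegularEpi hf
  isIso_of_mono_of_strongEpi f

end IsExtensionClass

section IsDoubleExtension

variable {E : MorphismProperty Y} {O : ObjectProperty Y} [hE : IsExtensionClass E O]
  {A₁ B₁ D₁ A₀ B₀ D₀ : Y} {αt : A₁ ⟶ B₁} {βt : B₁ ⟶ D₁} {fA : A₁ ⟶ A₀} {fB : B₁ ⟶ B₀}
  {fD : D₁ ⟶ D₀} {αb : A₀ ⟶ B₀} {βb : B₀ ⟶ D₀}

include hE

open IsExtensionClass

namespace IsDoubleExtension

theorem of_isPullback {P : Y} {π₁ : P ⟶ A₀} {π₂ : P ⟶ B₁} {p : A₁ ⟶ P} (hb : E αb) (hB : E fB)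
    (hP : IsPullback π₁ π₂ αb fB) (h₁ : p ≫ π₁ = fA) (h₂ : p ≫ π₂ = αt) (hp : E p) :
    IsDoubleExtension E αt fA fB αb := by
  have hπ₁ : E π₁ := mem_of_isPullback hP.flip hB (source hb)
  have hπ₂ : E π₂ := mem_of_isPullback hP hb (source hB)
  exact ⟨by rw [← h₁, ← h₂, Category.assoc, Category.assoc, hP.w], h₂ ▸ E.comp_mem _ _ hp hπ₂,
    h₁ ▸ E.comp_mem _ _ hp hπ₁, hB, hb, P, π₁, π₂, p, hP, h₁, h₂, hπ₁, hπ₂, hp⟩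

theorem comparison_mem (h : IsDoubleExtension E αt fA fB αb) {P : Y} {π₁ : P ⟶ A₀} {π₂ : P ⟶ B₁}
    {p : A₁ ⟶ P} (hP : IsPullback π₁ π₂ αb fB) (h₁ : p ≫ π₁ = fA) (h₂ : p ≫ π₂ = αt) : E p := by
  obtain ⟨P', π₁', π₂', p', hP', h₁', h₂', -, -, hp'⟩ := h.comparison
  have hpp' : p = p' ≫ (hP'.isoIsPullback _ _ hP).hom := by
    apply hP.hom_ext <;> simp [*]
  rw [hpp']
  exact E.comp_mem _ _ hp' (mem_of_isIso _ (target hp'))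

theorem of_isIso (w : αt ≫ fB = fA ≫ αb) (ht : E αt) (hA : E fA) [IsIso αb] :
    IsDoubleExtension E αt fA fB αb := by
  have hb : E αb := mem_of_isIso αb (target hA)
  have hB : E fB := E.of_precomp αt fB ht (w ▸ E.comp_mem fA αb hA hb)
  refine of_isPullback hb hB (π₁ := fB ≫ inv αb) (π₂ := 𝟙 B₁)
    (IsPullback.of_vert_isIso ⟨by simp⟩) ?_ (Category.comp_id _) ht
  rw [reassoc_of% w, IsIso.hom_inv_id, Category.comp_id]

theorem isPullback (h : IsDoubleExtension E αt fA fB αb)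
    (hmono : ∀ ⦃Z : Y⦄ (x y : Z ⟶ A₁), x ≫ αt = y ≫ αt → x ≫ fA = y ≫ fA → x = y) :
    IsPullback αt fA fB αb := by
  obtain ⟨P, π₁, π₂, p, hP, rfl, rfl, -, -, hp⟩ := h.comparison
  have : Mono p :=
    ⟨fun x y hxy => hmono x y (by simp [reassoc_of% hxy]) (by simp [reassoc_of% hxy])⟩
  have := isIso_of_mono hp
  exact hP.flip.of_iso (asIso p).symm (Iso.refl _) (Iso.refl _) (Iso.refl _)
    (by simp) (by simp) (by simp) (by simp)

variable [HasPullbacks Y]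

theorem comp (hα : IsDoubleExtension E αt fA fB αb) (hβ : IsDoubleExtension E βt fB fD βb) :
    IsDoubleExtension E (αt ≫ βt) fA fD (αb ≫ βb) := by
  have hQ := IsPullback.of_hasPullback βb fD
  have hM := IsPullback.of_hasPullback αb fB
  have hN := IsPullback.of_hasPullback αb (pullback.fst βb fD)
  let q := hQ.lift fB βt hβ.comm.symm
  let p := hM.lift fA αt hα.comm.symm
  let m := hN.lift (pullback.fst αb fB) (pullback.snd αb fB ≫ q) (by simp [q, hM.w])
  have hq : E q := hβ.comparison_mem hQ (by simp [q]) (by simp [q])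
  have hp : E p := hα.comparison_mem hM (by simp [p]) (by simp [p])
  have hm : IsPullback m (pullback.snd αb fB) (pullback.snd αb (pullback.fst βb fD)) q :=
    IsPullback.of_right (by simpa [m, q] using hM) (by simp [m]) hN
  have hmE : E m := mem_of_isPullback hm.flip hq <| source <|
    mem_of_isPullback hN.flip
      (mem_of_isPullback hQ.flip hβ.right_mem (source hβ.bot_mem)) (source hα.bot_mem)
  exact of_isPullback (E.comp_mem _ _ hα.bot_mem hβ.bot_mem) hβ.right_mem
    (hN.flip.paste_horiz hQ.flip).flip (p := p ≫ m) (by simp [p, m]) (by simp [p, m, q])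
    (E.comp_mem _ _ hp hmE)

theorem of_precomp (w : βt ≫ fD = fB ≫ βb) (hα : IsDoubleExtension E αt fA fB αb)
    (h : IsDoubleExtension E (αt ≫ βt) fA fD (αb ≫ βb)) : IsDoubleExtension E βt fB fD βb := by
  have hQ := IsPullback.of_hasPullback βb fD
  have hN := IsPullback.of_hasPullback αb (pullback.fst βb fD)
  have hb : E βb := E.of_precomp _ _ hα.bot_mem h.bot_mem
  let q := hQ.lift fB βt w.symm
  let p := hN.lift fA (αt ≫ q) (by simp [q, hα.comm])
  have hp : E p := h.comparison_mem (hN.flip.paste_horiz hQ.flip).flip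
    (by simp [p]) (by simp [p, q])
  have hsnd : E (pullback.snd αb (pullback.fst βb fD)) :=
    mem_of_isPullback hN hα.bot_mem
      (source (mem_of_isPullback hQ.flip h.right_mem (source hb)))
  have hpq : p ≫ pullback.snd αb (pullback.fst βb fD) = αt ≫ q := hN.lift_snd _ _ _
  exact of_isPullback (p := q) hb h.right_mem hQ (by simp [q]) (by simp [q])
    (E.of_precomp αt q hα.top_mem (hpq ▸ E.comp_mem _ _ hp hsnd))

theorem baseChange {P₁ P₀ : Y} {xt : P₁ ⟶ D₁} {yt : P₁ ⟶ A₁} {xb : P₀ ⟶ D₀} {yb : P₀ ⟶ A₀}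
    {fP : P₁ ⟶ P₀} {γt : D₁ ⟶ B₁} {γb : D₀ ⟶ B₀} (hα : IsDoubleExtension E αt fA fB αb)
    (hD : E fD) (ht : IsPullback yt xt αt γt) (hb : IsPullback yb xb αb γb)
    (wγ : γt ≫ fB = fD ≫ γb) (wx : xt ≫ fD = fP ≫ xb) (wy : yt ≫ fA = fP ≫ yb) :
    IsDoubleExtension E xt fP fD xb := by
  have hM := IsPullback.of_hasPullback αb fB
  have hN := IsPullback.of_hasPullback xb fD
  have hxb : E xb := mem_of_isPullback hb hα.bot_mem (target hD)
  let p := hM.lift fA αt hα.comm.symm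
  have hp : E p := hα.comparison_mem hM (by simp [p]) (by simp [p])
  let n := hM.lift (pullback.fst xb fD ≫ yb) (pullback.snd xb fD ≫ γt)
    (by rw [Category.assoc, Category.assoc, hb.w, wγ, hN.w_assoc])
  let c := hN.lift fP xt wx.symm
  have hn : IsPullback n (pullback.snd xb fD) (pullback.snd αb fB) γt := by
    refine IsPullback.of_right ?_ (by simp [n]) hM
    simpa only [n, hM.lift_fst, wγ] using hN.paste_horiz hb
  have hc : IsPullback yt c p n := by
    refine IsPullback.of_bot ?_ ?_ hn
    · simpa [c, p] using ht
    · apply hM.hom_ext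
      · simp [p, n, c, wy]
      · simp [p, n, c, ht.w]
  exact of_isPullback hxb hD hN (p := c) (by simp [c]) (by simp [c])
    (mem_of_isPullback hc hp
      (source (mem_of_isPullback hN.flip hD (source hxb))))

end IsDoubleExtension

theorem exists_projective_doubleExtensions [HasPullbacks Y] (B : Arrow Y) (hB : E B.hom) :
    ∃ (Q : Arrow Y) (γ : Q ⟶ B),
      doubleExtensions E γ ∧ IsProjectiveFor (doubleExtensions E) Q := by
  obtain ⟨Q₀, γb, hγb, hQ₀⟩ := exists_projective (E := E) B.right (target hB)
  have hM := IsPullback.of_hasPullback γb B.hom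
  obtain ⟨Q₁, p, hp, hQ₁⟩ := exists_projective (E := E) (pullback γb B.hom)
    (source (mem_of_isPullback hM.flip hB (source hγb)))
  have hγ : IsDoubleExtension E (p ≫ pullback.snd γb B.hom) (p ≫ pullback.fst γb B.hom) B.hom γb :=
    .of_isPullback hγb hB hM rfl rfl hp
  exact ⟨Arrow.mk (p ≫ pullback.fst γb B.hom), Arrow.homMk _ γb hγ.comm, hγ, hQ₁.arrow hQ₀⟩

theorem isRegularEpi_of_doubleExtensions [HasPullbacks Y] {A B : Arrow Y} {f : A ⟶ B}
    (hf : doubleExtensions E f) : IsRegularEpi f := by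
  have := isRegularEpi hf.top_mem
  have := isRegularEpi hf.bot_mem
  have : Epi f := ⟨fun a b h => Arrow.hom_ext _ _
    ((cancel_epi f.left).1 (congrArg CommaMorphism.left h))
    ((cancel_epi f.right).1 (congrArg CommaMorphism.right h))⟩
  have hK := IsKernelPair.of_hasPullback f
  refine IsRegularEpi.of_epi_of_exists fun Z k hk => ?_
  obtain ⟨l₁, h₁⟩ := IsRegularEpi.exists_of_isKernelPair f.left (hK.map Arrow.leftFunc)
    k.left (congrArg CommaMorphism.left hk)
  obtain ⟨l₀, h₀⟩ := IsRegularEpi.exists_of_isKernelPair f.right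
    (hK.map Arrow.rightFunc) k.right (congrArg CommaMorphism.right hk)
  refine ⟨Arrow.homMk l₁ l₀ ?_, Arrow.hom_ext _ _ h₁ h₀⟩
  rw [← cancel_epi f.left, reassoc_of% h₁, Arrow.w k, ← h₀, Arrow.w_assoc]

instance isExtensionClass_doubleExtensions [HasPullbacks Y] :
    IsExtensionClass (doubleExtensions E) (fun f : Arrow Y => E f.hom) where
  source _ _ _ hf := hf.left_mem
  target _ _ _ hf := hf.right_mem
  mem_of_isIso _ _ f _ hA := .of_isIso (Arrow.w f)
    (mem_of_isIso f.left (source hA)) hA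
  comp_mem _ _ hf hg := IsDoubleExtension.comp hf hg
  of_precomp _ g hf hfg := IsDoubleExtension.of_precomp (Arrow.w g) hf hfg
  mem_of_isPullback _ _ _ _ fst snd _ g hP hf hD := IsDoubleExtension.baseChange hf hD
    (hP.map Arrow.leftFunc) (hP.map Arrow.rightFunc) (Arrow.w g) (Arrow.w snd) (Arrow.w fst)
  isRegularEpi _ _ _ hf := isRegularEpi_of_doubleExtensions hf
  exists_projective B hB := exists_projective_doubleExtensions B hB

end IsDoubleExtension

/-- `V` behaves, relative to the class `E` of extensions, like the class of morphisms of cubes that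
are invertible away from the initial vertex: extensions in `V` have pushouts along extensions, since
these can be computed at that vertex. -/
class IsCornerClass (V : MorphismProperty Y) (E : outParam (MorphismProperty Y)) : Prop
    extends V.RespectsIso, V.HasOfPostcompProperty V where
  mem_of_isPullback : ∀ ⦃P A B D : Y⦄ {fst : P ⟶ A} {snd : P ⟶ D} {f : A ⟶ B} {g : D ⟶ B},
    IsPullback fst snd f g → E f → V g → V fst
  exists_isPushout : ∀ ⦃X T A : Y⦄ {τ : X ⟶ T} {π : X ⟶ A}, V τ → E τ → E π →
    ∃ (D : Y) (r : T ⟶ D) (h : A ⟶ D), IsPushout τ π r h ∧ V h ∧ E h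

/-- The morphisms of arrows that are invertible at the codomain and belong to `V` at the domain. -/
def cornerMorphisms (V : MorphismProperty Y) : MorphismProperty (Arrow Y) :=
  V.inverseImage Arrow.leftFunc ⊓ (MorphismProperty.isomorphisms Y).inverseImage Arrow.rightFunc

instance respectsIso_cornerMorphisms {V : MorphismProperty Y} [V.RespectsIso] :
    (cornerMorphisms V).RespectsIso :=
  inferInstanceAs (V.inverseImage _ ⊓ _).RespectsIso

section CornerMorphisms

variable {E : MorphismProperty Y} {O : ObjectProperty Y} [hE : IsExtensionClass E O]
  {V : MorphismProperty Y} [hV : IsCornerClass V E]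

include hE hV

theorem exists_isPushout_cornerMorphisms {X T A : Arrow Y} {τ : X ⟶ T} {π : X ⟶ A}
    (hτ : cornerMorphisms V τ) (hτE : doubleExtensions E τ) (hπ : doubleExtensions E π) :
    ∃ (D : Arrow Y) (r : T ⟶ D) (h : A ⟶ D),
      IsPushout τ π r h ∧ cornerMorphisms V h ∧ doubleExtensions E h := by
  obtain ⟨hτV, hτ₀ : IsIso τ.right⟩ := hτ
  obtain ⟨D, r, h, hD, hhV, hhE⟩ :=
    IsCornerClass.exists_isPushout (V := V) hτV hτE.top_mem hπ.top_mem
  have w : τ.left ≫ T.hom ≫ inv τ.right ≫ π.right = π.left ≫ A.hom := by simp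
  let d : D ⟶ A.right := hD.desc _ _ w
  let h' : A ⟶ Arrow.mk d :=
    Arrow.homMk h (𝟙 A.right) ((hD.inr_desc _ _ w).trans (Category.comp_id A.hom).symm)
  have hright : IsPushout τ.right π.right (inv τ.right ≫ π.right) (𝟙 A.right) :=
    IsPushout.of_horiz_isIso ⟨by simp⟩
  exact ⟨Arrow.mk d, Arrow.homMk r (inv τ.right ≫ π.right) (hD.inl_desc _ _ w), h',
    isPushout_of_isPushout_left_right hD hright, ⟨hhV, inferInstanceAs (IsIso (𝟙 A.right))⟩,
    IsDoubleExtension.of_isIso (Arrow.w h') hhE hπ.right_mem (αb := 𝟙 A.right)⟩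

instance isCornerClass_cornerMorphisms [HasPullbacks Y] :
    IsCornerClass (cornerMorphisms V) (doubleExtensions E) where
  toRespects := respectsIso_cornerMorphisms
  of_postcomp f g hg hfg :=
    ⟨V.of_postcomp f.left g.left hg.1 hfg.1,
      (MorphismProperty.isomorphisms Y).of_postcomp f.right g.right hg.2 hfg.2⟩
  mem_of_isPullback _ _ _ _ _ _ _ _ hP hf hg :=
    ⟨IsCornerClass.mem_of_isPullback (V := V) (hP.map Arrow.leftFunc) hf.top_mem hg.1,
      (hP.map Arrow.rightFunc).isIso_fst_of_isIso hg.2⟩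
  exists_isPushout _ _ _ _ _ := exists_isPushout_cornerMorphisms

end CornerMorphisms

end ExtensionClasses

section Coequalisers

variable {C : Type w} [Category.{w'} C] {R S X T A D : C} {d₁ d₂ : R ⟶ X} {s₁ s₂ : S ⟶ T}
  {τ : X ⟶ T} {e : R ⟶ S} {π : X ⟶ A} {r : T ⟶ D} {hπ : d₁ ≫ π = d₂ ≫ π}

theorem exists_isPushout_of_isColimit [Epi e] (h₁ : e ≫ s₁ = d₁ ≫ τ) (h₂ : e ≫ s₂ = d₂ ≫ τ)
    (cπ : IsColimit (Cofork.ofπ π hπ)) {hr : s₁ ≫ r = s₂ ≫ r} (cr : IsColimit (Cofork.ofπ r hr)) :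
    ∃ h : A ⟶ D, IsPushout τ π r h := by
  have hτr : d₁ ≫ τ ≫ r = d₂ ≫ τ ≫ r := by rw [← reassoc_of% h₁, ← reassoc_of% h₂, hr]
  obtain ⟨h, hh⟩ : ∃ h : A ⟶ D, π ≫ h = τ ≫ r :=
    ⟨cπ.desc (Cofork.ofπ _ hτr), Cofork.IsColimit.π_desc cπ⟩
  refine ⟨h, .mk' hh.symm (fun Z x y hxy _ => Cofork.IsColimit.hom_ext cr hxy) fun Z a b hab => ?_⟩
  have ha : s₁ ≫ a = s₂ ≫ a := by
    rw [← cancel_epi e, reassoc_of% h₁, reassoc_of% h₂, hab, reassoc_of% hπ]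
  have hra : r ≫ cr.desc (Cofork.ofπ a ha) = a := Cofork.IsColimit.π_desc cr
  refine ⟨_, hra, Cofork.IsColimit.hom_ext cπ ?_⟩
  change π ≫ h ≫ _ = π ≫ b
  rw [reassoc_of% hh, hra, hab]

theorem exists_isColimit_of_isPushout [Epi e] (h₁ : e ≫ s₁ = d₁ ≫ τ) (h₂ : e ≫ s₂ = d₂ ≫ τ)
    (cπ : IsColimit (Cofork.ofπ π hπ)) {h : A ⟶ D} (hpo : IsPushout τ π r h) :
    ∃ hr : s₁ ≫ r = s₂ ≫ r, Nonempty (IsColimit (Cofork.ofπ r hr)) := by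
  have hr : s₁ ≫ r = s₂ ≫ r := by
    rw [← cancel_epi e, reassoc_of% h₁, reassoc_of% h₂, hpo.w, reassoc_of% hπ]
  have hex : ∀ s : Cofork s₁ s₂, ∃ l : D ⟶ s.pt, r ≫ l = s.π ∧ π ≫ h ≫ l = τ ≫ s.π := fun s => by
    have hs : d₁ ≫ τ ≫ s.π = d₂ ≫ τ ≫ s.π := by
      rw [← reassoc_of% h₁, ← reassoc_of% h₂, s.condition]
    have hπs : π ≫ cπ.desc (Cofork.ofπ _ hs) = τ ≫ s.π := Cofork.IsColimit.π_desc cπ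
    exact ⟨hpo.desc s.π _ hπs.symm, hpo.inl_desc _ _ _, by rw [hpo.inr_desc, hπs]⟩
  choose l hl hπl using hex
  refine ⟨hr, ⟨Cofork.IsColimit.mk _ l hl fun s m hm => hpo.hom_ext (hm.trans (hl s).symm) ?_⟩⟩
  have hm' : r ≫ m = s.π := hm
  refine Cofork.IsColimit.hom_ext cπ ?_
  change π ≫ h ≫ m = π ≫ h ≫ l s
  rw [hπl, ← reassoc_of% hpo.w, hm']

end Coequalisers

section RegularEpis

variable {C : Type w} [Category.{w'} C] [Regular C]

theorem exists_isReflexivePair_of_isRegularEpi {R X T : C} (τ : X ⟶ T) [IsRegularEpi τ]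
    (d₁ d₂ : R ⟶ X) [IsReflexivePair d₁ d₂] :
    ∃ (S : C) (e : R ⟶ S) (s₁ s₂ : S ⟶ T), IsRegularEpi e ∧ IsReflexivePair s₁ s₂ ∧
      e ≫ s₁ = d₁ ≫ τ ∧ e ≫ s₂ = d₂ ≫ τ := by
  let F := Regular.strongEpiMonoFactorisation (prod.lift (d₁ ≫ τ) (d₂ ≫ τ))
  have h₁ : F.e ≫ F.m ≫ prod.fst = d₁ ≫ τ := by rw [F.fac_assoc, prod.lift_fst]
  have h₂ : F.e ≫ F.m ≫ prod.snd = d₂ ≫ τ := by rw [F.fac_assoc, prod.lift_snd]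
  have sq : CommSq (commonSection d₁ d₂ ≫ F.e) τ F.m (prod.lift (𝟙 T) (𝟙 T)) :=
    ⟨by ext <;> simp [F]⟩
  refine ⟨F.I, F.e, F.m ≫ prod.fst, F.m ≫ prod.snd, inferInstance, ?_, h₁, h₂⟩
  exact .mk' sq.lift (by rw [sq.fac_right_assoc, prod.lift_fst])
    (by rw [sq.fac_right_assoc, prod.lift_snd])

theorem isRegularEpi_of_comp {A B D : C} (f : A ⟶ B) (g : B ⟶ D) [IsRegularEpi (f ≫ g)] :
    IsRegularEpi g :=
  have := strongEpi_of_strongEpi f g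
  inferInstance

theorem isRegularEpi_comp {A B D : C} (f : A ⟶ B) (g : B ⟶ D) [IsRegularEpi f] [IsRegularEpi g] :
    IsRegularEpi (f ≫ g) :=
  have := strongEpi_comp f g
  inferInstance

theorem exists_isPushout_of_isRegularEpi [HasReflexiveCoequalizers C] {X T A : C} (τ : X ⟶ T)
    (π : X ⟶ A) [IsRegularEpi τ] [IsRegularEpi π] :
    ∃ (D : C) (r : T ⟶ D) (h : A ⟶ D), IsPushout τ π r h ∧ IsRegularEpi h := by
  have hπ : IsKernelPair π _ _ := IsKernelPair.of_hasPullback π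
  have := hπ.isReflexivePair
  obtain ⟨S, e, s₁, s₂, he, hs, h₁, h₂⟩ :=
    exists_isReflexivePair_of_isRegularEpi τ (pullback.fst π π) (pullback.snd π π)
  have := HasReflexiveCoequalizers.has_coeq s₁ s₂
  obtain ⟨h, hpo⟩ := exists_isPushout_of_isColimit h₁ h₂ hπ.toCoequalizer'
    (coequalizerIsCoequalizer s₁ s₂)
  have : IsRegularEpi (π ≫ h) := hpo.w ▸ isRegularEpi_comp τ (coequalizer.π s₁ s₂)
  exact ⟨_, _, h, hpo, isRegularEpi_of_comp π h⟩

instance [EnoughRegularProjectives C] :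
    IsExtensionClass (MorphismProperty.regularEpi C) ⊤ where
  source _ _ _ _ := trivial
  target _ _ _ _ := trivial
  mem_of_isIso _ _ f _ _ := inferInstanceAs (IsRegularEpi f)
  comp_mem f g (_ : IsRegularEpi f) (_ : IsRegularEpi g) := isRegularEpi_comp f g
  of_precomp f g _ (_ : IsRegularEpi (f ≫ g)) := isRegularEpi_of_comp f g
  mem_of_isPullback _ _ _ _ _ _ _ _ hP hf _ :=
    Regular.regularEpiIsStableUnderBaseChange.of_isPullback hP hf
  isRegularEpi _ _ _ hf := hf
  exists_projective B _ := EnoughRegularProjectives.presentation B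

instance [HasReflexiveCoequalizers C] : IsCornerClass ⊤ (MorphismProperty.regularEpi C) where
  mem_of_isPullback _ _ _ _ _ _ _ _ _ _ _ := trivial
  exists_isPushout _ _ _ τ π _ (_ : IsRegularEpi τ) (_ : IsRegularEpi π) := by
    obtain ⟨D, r, h, hpo, hh⟩ := exists_isPushout_of_isRegularEpi τ π
    exact ⟨D, r, h, hpo, trivial, hh⟩

end RegularEpis

section ArrowTower

variable (C : Type (max u v)) [Category.{v} C]

/-- The morphisms of `n`-fold arrows, seen as `n`-cubes, that are invertible away from the initial
vertex. -/
def corner : (n : ℕ) → MorphismProperty (arr.{v, u} C n)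
  | 0 => (⊤ : MorphismProperty C)
  | n + 1 => cornerMorphisms (corner n)

instance hasPullbacks_arr [HasPullbacks C] : ∀ n : ℕ, HasPullbacks (arr.{v, u} C n)
  | 0 => inferInstanceAs (HasPullbacks C)
  | n + 1 =>
    have := hasPullbacks_arr n
    inferInstanceAs (HasPullbacks (Arrow (arr.{v, u} C n)))

variable [Regular C] [EnoughRegularProjectives C]

instance isExtensionClass_ext : ∀ n : ℕ, IsExtensionClass (ext.{v, u} C n) (isExt.{v, u} C n)
  | 0 => inferInstanceAs (IsExtensionClass (MorphismProperty.regularEpi C) ⊤)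
  | n + 1 =>
    have := isExtensionClass_ext n
    inferInstanceAs (IsExtensionClass (doubleExtensions (ext.{v, u} C n)) _)

instance isCornerClass_corner [HasReflexiveCoequalizers C] :
    ∀ n : ℕ, IsCornerClass (corner.{v, u} C n) (ext.{v, u} C n)
  | 0 => inferInstanceAs (IsCornerClass ⊤ (MorphismProperty.regularEpi C))
  | n + 1 =>
    have := isCornerClass_corner n
    inferInstanceAs (IsCornerClass (cornerMorphisms (corner.{v, u} C n)) (doubleExtensions _))

end ArrowTower

section FullSubcategories

variable {Y : Type w} [Category.{w'} Y] {E : MorphismProperty Y} {O : ObjectProperty Y}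
  [hE : IsExtensionClass E O] [HasPullbacks Y]

section

variable {A B D : O.FullSubcategory} (f : A ⟶ B) (g : D ⟶ B) (hf : E f.hom)

include hE hf

open IsExtensionClass in
theorem nonempty_createsLimit_cospan_ι : Nonempty (CreatesLimit (cospan f g) O.ι) :=
  have h := IsPullback.of_hasPullback f.hom g.hom
  ⟨createsLimitFullSubcategoryInclusion' (cospan f g)
    (c := (Cone.postcompose (cospanCompIso O.ι f g).inv).obj h.cone)
    ((IsLimit.postcomposeInvEquiv _ _).symm h.isLimit)
    (source (mem_of_isPullback h hf D.property))⟩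

theorem hasPullback_of_mem_hom : HasPullback f g :=
  have ⟨_⟩ := nonempty_createsLimit_cospan_ι f g hf
  hasLimit_of_created _ O.ι

variable {f g} in
theorem isPullback_hom {P : O.FullSubcategory} {fst : P ⟶ A} {snd : P ⟶ D}
    (h : IsPullback fst snd f g) : IsPullback fst.hom snd.hom f.hom g.hom :=
  have ⟨_⟩ := nonempty_createsLimit_cospan_ι f g hf
  h.map O.ι

end

instance hasPullbacks_inverseImage_ι : (E.inverseImage O.ι).HasPullbacks where
  hasPullback g hf := hasPullback_of_mem_hom _ g hf

theorem isRegularEpi_of_isRegularEpi_hom {A B : O.FullSubcategory} {f : A ⟶ B}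
    (hf : E f.hom) : IsRegularEpi f := by
  have := IsExtensionClass.isRegularEpi hf
  have : Epi f := O.ι.epi_of_epi_map (IsExtensionClass.epi hf)
  have := hasPullback_of_mem_hom f f hf
  have hK := isPullback_hom hf (IsKernelPair.of_hasPullback f)
  refine IsRegularEpi.of_epi_of_exists fun Z k hk => ?_
  obtain ⟨l, hl⟩ := IsRegularEpi.exists_of_isKernelPair f.hom hK k.hom (congrArg O.ι.map hk)
  exact ⟨ObjectProperty.homMk l, O.ι.map_injective hl⟩

instance : IsExtensionClass (E.inverseImage O.ι) ⊤ where
  source _ _ _ _ := trivial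
  target _ _ _ _ := trivial
  mem_of_isIso A _ f _ _ := IsExtensionClass.mem_of_isIso (O.ι.map f) A.property
  of_precomp f g hf hfg := E.of_precomp f.hom g.hom hf hfg
  mem_of_isPullback _ _ _ D _ _ _ _ hP hf _ :=
    IsExtensionClass.mem_of_isPullback (E := E) (isPullback_hom hf hP) hf D.property
  isRegularEpi _ _ _ hf := isRegularEpi_of_isRegularEpi_hom hf
  exists_projective B _ := by
    obtain ⟨P, p, hp, hP⟩ := IsExtensionClass.exists_projective (E := E) B.obj B.property
    refine ⟨⟨P, IsExtensionClass.source hp⟩, ObjectProperty.homMk p, hp, fun A D e he b => ?_⟩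
    obtain ⟨a, ha⟩ := hP e.hom he b.hom
    exact ⟨ObjectProperty.homMk a, O.ι.map_injective ha⟩

instance {V : MorphismProperty Y} [IsCornerClass V E] :
    IsCornerClass (V.inverseImage O.ι) (E.inverseImage O.ι) where
  of_postcomp f g hg hfg := V.of_postcomp f.hom g.hom hg hfg
  mem_of_isPullback _ _ _ _ _ _ _ _ hP hf hg :=
    IsCornerClass.mem_of_isPullback (V := V) (isPullback_hom hf hP) hf hg
  exists_isPushout X T A τ π hτ hτE hπ := by
    obtain ⟨D, r, h, hD, hhV, hhE⟩ := IsCornerClass.exists_isPushout (V := V) hτ hτE hπ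
    exact ⟨⟨D, IsExtensionClass.target hhE⟩, ObjectProperty.homMk r, ObjectProperty.homMk h,
      IsPushout.of_map_of_faithful O.ι hD, hhV, hhE⟩

end FullSubcategories

section Pullbacks

variable {Y : Type w} [Category.{w'} Y]

theorem exists_isPullback_of_mem {E : MorphismProperty Y} [E.HasPullbacks] {A B D : Y} (f : A ⟶ B)
    {g : D ⟶ B} (hg : E g) :
    ∃ (P : Y) (fst : P ⟶ A) (snd : P ⟶ D), IsPullback fst snd f g :=
  have := MorphismProperty.HasPullbacks.hasPullback f hg
  ⟨_, _, _, (IsPullback.of_hasPullback g f).flip⟩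

theorem isPullback_of_isKernelPair {X A P B R Q : Y} {πA : X ⟶ A} {πP : X ⟶ P} {f : A ⟶ B}
    {p : P ⟶ B} {d₁ d₂ : R ⟶ X} {q₁ q₂ : Q ⟶ P} {k : R ⟶ Q} (h : IsPullback πA πP f p)
    (hR : IsKernelPair πA d₁ d₂) (hQ : IsKernelPair p q₁ q₂) (h₁ : k ≫ q₁ = d₁ ≫ πP)
    (h₂ : k ≫ q₂ = d₂ ≫ πP) : IsPullback d₁ k πP q₁ := by
  refine (IsPullback.of_right ?_ h₁ hQ.flip).flip
  rw [h₂, ← h.w]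
  exact hR.flip.paste_horiz h.flip

end Pullbacks

namespace GaloisStructure

variable {Y : Type w} [Category.{w'} Y] {E : MorphismProperty Y}

theorem η_naturality (Γ : GaloisStructure E) {A B : Y} (f : A ⟶ B) :
    Γ.η A ≫ Γ.reflMap f = f ≫ Γ.η B :=
  (Γ.adj.unit.naturality f).symm

variable {Γ : GaloisStructure E} {A B A' B' : Y} {f : A ⟶ B} {f' : A' ⟶ B'}

namespace Trivialisation

theorem exists_map (T : Γ.Trivialisation f) (T' : Γ.Trivialisation f') {a : A ⟶ A'} {b : B ⟶ B'}
    (w : a ≫ f' = f ≫ b) :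
    ∃ m : T.obj ⟶ T'.obj,
      m ≫ T'.map = T.map ≫ b ∧ m ≫ T'.toRefl = T.toRefl ≫ Γ.reflMap a := by
  have hw : (T.toRefl ≫ Γ.reflMap a) ≫ Γ.reflMap f' = (T.map ≫ b) ≫ Γ.η B' := by
    simp only [Category.assoc, ← Functor.map_comp, w]
    simp only [Functor.map_comp, ← η_naturality, T.isPullback.w_assoc]
  exact ⟨T'.isPullback.lift _ _ hw, T'.isPullback.lift_snd _ _ hw, T'.isPullback.lift_fst _ _ hw⟩

theorem τ_naturality {T : Γ.Trivialisation f} {T' : Γ.Trivialisation f'} {a : A ⟶ A'} {b : B ⟶ B'}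
    {m : T.obj ⟶ T'.obj} (w : a ≫ f' = f ≫ b) (hmap : m ≫ T'.map = T.map ≫ b)
    (hrefl : m ≫ T'.toRefl = T.toRefl ≫ Γ.reflMap a) : T.τ ≫ m = a ≫ T'.τ := by
  apply T'.isPullback.hom_ext
  · simp only [Category.assoc, hrefl, T'.τ_toRefl, reassoc_of% T.τ_toRefl, η_naturality]
  · simp only [Category.assoc, hmap, T'.τ_map, reassoc_of% T.τ_map, w]

theorem exists_lift (T : Γ.Trivialisation f) {t : A' ⟶ B'} (ht : Γ.trivialCovering t) {a : A ⟶ A'}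
    {b : B ⟶ B'} (w : a ≫ t = f ≫ b) :
    ∃ l : T.obj ⟶ A', T.τ ≫ l = a ∧ l ≫ t = T.map ≫ b := by
  let T' : Γ.Trivialisation t :=
    ⟨A', t, Γ.η A', ht.2, 𝟙 A', Category.id_comp t, Category.id_comp (Γ.η A')⟩
  obtain ⟨l, hmap, hrefl⟩ := T.exists_map T' w
  exact ⟨l, (τ_naturality w hmap hrefl).trans (Category.comp_id a), hmap⟩

end Trivialisation

theorem exists_trivialisation [E.HasPullbacks] (hΓ : Γ.StronglyBirkhoff) (hf : E f) :
    Nonempty (Γ.Trivialisation f) := by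
  obtain ⟨T, map, toRefl, hT⟩ := exists_isPullback_of_mem (Γ.η B) (hΓ f hf).right_mem
  obtain ⟨τ, hmap, htoRefl⟩ := hT.exists_lift f (Γ.η A) (Γ.η_naturality f).symm
  exact ⟨⟨T, map, toRefl, hT.flip, τ, hmap, htoRefl⟩⟩

theorem TrivialisedPresentation.exists_lift (D : Γ.TrivialisedPresentation f)
    {S S' : Y} {c : S ⟶ S'} (hc : Γ.covering c) {a : A ⟶ S} {b : B ⟶ S'}
    (w : a ≫ c = f ≫ b) : ∃ k : D.trivX.obj ⟶ S, D.trivX.τ ≫ k = D.πA ≫ a := by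
  obtain ⟨-, U, T, e, t, x, he, hT, ht⟩ := hc
  obtain ⟨s, hs⟩ := D.projective e he (D.p ≫ b)
  obtain ⟨k, hkx, hkt⟩ := hT.exists_lift (D.πA ≫ a) (D.πP ≫ s)
    (by simp only [Category.assoc, w, hs, D.isPullback.w_assoc])
  obtain ⟨l, hl, -⟩ := D.trivX.exists_lift ht hkt
  exact ⟨l ≫ x, by rw [reassoc_of% hl, hkx]⟩

open IsExtensionClass

variable [IsExtensionClass E ⊤]

namespace TrivialisedPresentation

variable (D : Γ.TrivialisedPresentation f)

theorem πA_mem : E D.πA :=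
  mem_of_isPullback D.isPullback.flip D.p_mem trivial

theorem πP_mem (hf : E f) : E D.πP :=
  mem_of_isPullback D.isPullback hf trivial

end TrivialisedPresentation

variable (hΓ : Γ.StronglyBirkhoff)

include hΓ

namespace Trivialisation

theorem τ_mem (T : Γ.Trivialisation f) (hf : E f) : E T.τ :=
  (hΓ f hf).comparison_mem T.isPullback.flip T.τ_map T.τ_toRefl

theorem trivialCovering_map (T : Γ.Trivialisation f) (hf : E f) : Γ.trivialCovering T.map := by
  have hT : E T.map := mem_of_isPullback T.isPullback (hΓ f hf).right_mem trivial
  obtain ⟨m, hm⟩ := (Γ.adj.homEquiv T.obj (Γ.L.obj A)).surjective T.toRefl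
  replace hm : Γ.η T.obj ≫ m.hom = T.toRefl := (Γ.adj.homEquiv_unit ..).symm.trans hm
  refine ⟨hT, (hΓ T.map hT).isPullback fun Z x y h₁ h₂ => T.isPullback.hom_ext ?_ h₂⟩
  rw [← hm, reassoc_of% h₁]

end Trivialisation

namespace TrivialisedPresentation

variable (D : Γ.TrivialisedPresentation f) {r : D.trivX.obj ⟶ A'} {h : A ⟶ A'}

theorem exists_isPushout {V : MorphismProperty Y} [IsCornerClass V E]
    (hV : ∀ A : Y, V (Γ.η A)) (hf : E f) :
    ∃ (A' : Y) (r : D.trivX.obj ⟶ A') (h : A ⟶ A'),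
      IsPushout D.trivX.τ D.πA r h ∧ V h ∧ E h := by
  have hπP := D.πP_mem hf
  have htoRefl : V D.trivX.toRefl :=
    IsCornerClass.mem_of_isPullback D.trivX.isPullback (hΓ D.πP hπP).right_mem (hV D.P)
  have hτ : V D.trivX.τ :=
    V.of_postcomp D.trivX.τ D.trivX.toRefl htoRefl (D.trivX.τ_toRefl ▸ hV D.X)
  exact IsCornerClass.exists_isPushout hτ (D.trivX.τ_mem hΓ hπP) D.πA_mem

theorem exists_isColimit (hf : E f) (hpo : IsPushout D.trivX.τ D.πA r h) :
    ∃ hr : D.π₁ ≫ r = D.π₂ ≫ r, Nonempty (IsColimit (Cofork.ofπ r hr)) := by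
  have hfhat : E D.fhat := mem_of_isPullback (isPullback_of_isKernelPair D.isPullback
    D.isKernelPair_πA D.isKernelPair_p D.fhat_q₁ D.fhat_q₂) (D.πP_mem hf) trivial
  have := epi (D.trivR.τ_mem hΓ hfhat)
  have := isRegularEpi D.πA_mem
  exact exists_isColimit_of_isPushout
    (Trivialisation.τ_naturality D.fhat_q₁.symm D.π₁_map D.π₁_toRefl)
    (Trivialisation.τ_naturality D.fhat_q₂.symm D.π₂_map D.π₂_toRefl)
    D.isKernelPair_πA.toCoequalizer' hpo

end TrivialisedPresentation

variable [E.HasPullbacks]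

theorem trivialCovering_of_comp {S T T' : Y} {e : T ⟶ T'} {t : T' ⟶ S} (he : E e)
    (het : Γ.trivialCovering (e ≫ t)) : Γ.trivialCovering t := by
  have ht : E t := E.of_precomp e t he het.1
  have he' : IsPullback (Γ.η T) e (Γ.reflMap e) (Γ.η T') :=
    (hΓ e he).isPullback fun Z x y h₁ h₂ => het.2.hom_ext h₁ (by rw [reassoc_of% h₂])
  refine ⟨ht, (hΓ t ht).isPullback fun Z x y hη hxy => ?_⟩
  obtain ⟨K, q, k, hK⟩ := exists_isPullback_of_mem x he
  have := epi (mem_of_isPullback hK.flip he trivial)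
  obtain ⟨z, hzη, hze⟩ := he'.exists_lift (k ≫ Γ.η T) (q ≫ y)
    (by rw [Category.assoc, η_naturality, ← hK.w_assoc, hη, Category.assoc])
  have hz : z = k := het.2.hom_ext hzη (by rw [reassoc_of% hze, ← hxy, hK.w_assoc])
  rw [← cancel_epi q, hK.w, ← hz, hze]

theorem exists_trivialisedPresentation (hf : E f) : Nonempty (Γ.TrivialisedPresentation f) := by
  obtain ⟨P, p, p_mem, projective⟩ := exists_projective (E := E) B trivial
  obtain ⟨X, πA, πP, isPullback⟩ := exists_isPullback_of_mem f p_mem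
  have hπP : E πP := mem_of_isPullback isPullback hf trivial
  have hπA : E πA := mem_of_isPullback isPullback.flip p_mem trivial
  obtain ⟨R, d₁, d₂, isKernelPair_πA⟩ := exists_isPullback_of_mem πA hπA
  obtain ⟨Q, q₁, q₂, isKernelPair_p⟩ := exists_isPullback_of_mem p p_mem
  obtain ⟨fhat, fhat_q₁, fhat_q₂⟩ := isKernelPair_p.exists_lift (d₁ ≫ πP) (d₂ ≫ πP)
    (by simp only [Category.assoc, ← isPullback.w, isKernelPair_πA.w_assoc])
  have hfhat : E fhat := mem_of_isPullback
    (isPullback_of_isKernelPair isPullback isKernelPair_πA isKernelPair_p fhat_q₁ fhat_q₂)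
    hπP trivial
  obtain ⟨trivX⟩ := exists_trivialisation hΓ hπP
  obtain ⟨trivR⟩ := exists_trivialisation hΓ hfhat
  obtain ⟨π₁, π₁_map, π₁_toRefl⟩ := trivR.exists_map trivX fhat_q₁.symm
  obtain ⟨π₂, π₂_map, π₂_toRefl⟩ := trivR.exists_map trivX fhat_q₂.symm
  exact ⟨⟨P, p, p_mem, projective, X, πA, πP, isPullback, R, d₁, d₂, isKernelPair_πA, Q, q₁, q₂,
    isKernelPair_p, fhat, fhat_q₁, fhat_q₂, trivX, trivR, π₁, π₂, π₁_map, π₁_toRefl, π₂_map,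
    π₂_toRefl⟩⟩

namespace TrivialisedPresentation

variable (D : Γ.TrivialisedPresentation f) {r : D.trivX.obj ⟶ A'} {h : A ⟶ A'} {g : A' ⟶ B}

theorem covering_of_isPushout (hf : E f) (hpo : IsPushout D.trivX.τ D.πA r h) (hh : E h)
    (hrg : r ≫ g = D.trivX.map ≫ D.p) (hhg : h ≫ g = f) : Γ.covering g := by
  have hg : E g := E.of_precomp h g hh (hhg ▸ hf)
  obtain ⟨K, k, a, hK⟩ := exists_isPullback_of_mem D.p hg
  obtain ⟨e, hemap, her⟩ := hK.exists_lift D.trivX.map r hrg.symm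
  have hX : IsPullback D.πA (D.trivX.τ ≫ e) h a := by
    refine IsPullback.of_bot ?_ (by rw [Category.assoc, her, hpo.w]) hK.flip
    rw [Category.assoc, hemap, D.trivX.τ_map, hhg]
    exact D.isPullback
  have he : E e := E.of_precomp D.trivX.τ e (D.trivX.τ_mem hΓ (D.πP_mem hf))
    (mem_of_isPullback hX hh trivial)
  exact ⟨hg, D.P, K, D.p, k, a, D.p_mem, hK.flip, trivialCovering_of_comp hΓ he
    (hemap ▸ D.trivX.trivialCovering_map hΓ (D.πP_mem hf))⟩

theorem isCoveringReflection (hf : E f) (hpo : IsPushout D.trivX.τ D.πA r h) (hh : E h)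
    (hrg : r ≫ g = D.trivX.map ≫ D.p) (hhg : h ≫ g = f) : Γ.IsCoveringReflection f h g where
  fac := hhg
  covering := D.covering_of_isPushout hΓ hf hpo hh hrg hhg
  universal S S' c hc a b w := by
    have := epi hh
    obtain ⟨k, hk⟩ := D.exists_lift hc w
    refine ⟨hpo.desc k a hk, ⟨hpo.inr_desc _ _ _, ?_⟩, fun x hx => ?_⟩
    · rw [← cancel_epi h, hpo.inr_desc_assoc, w, reassoc_of% hhg]
    · rw [← cancel_epi h, hx.1, hpo.inr_desc]

theorem exists_isCoveringReflection {V : MorphismProperty Y} [IsCornerClass V E]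
    (hV : ∀ A : Y, V (Γ.η A)) (hf : E f) :
    ∃ (A' : Y) (r : D.trivX.obj ⟶ A') (h : A ⟶ A') (g : A' ⟶ B) (hr : D.π₁ ≫ r = D.π₂ ≫ r),
      Nonempty (IsColimit (Cofork.ofπ r hr)) ∧ D.trivX.τ ≫ r = D.πA ≫ h ∧
      r ≫ g = D.trivX.map ≫ D.p ∧ Γ.IsCoveringReflection f h g ∧ V h := by
  obtain ⟨A', r, h, hpo, hhV, hhE⟩ := D.exists_isPushout hΓ hV hf
  obtain ⟨hr, hcolim⟩ := D.exists_isColimit hΓ hf hpo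
  obtain ⟨g, hrg, hhg⟩ := hpo.exists_desc (D.trivX.map ≫ D.p) f
    (by rw [reassoc_of% D.trivX.τ_map, D.isPullback.w])
  exact ⟨A', r, h, g, hr, hcolim, hpo.w, hrg, D.isCoveringReflection hΓ hf hpo hhE hrg hhg, hhV⟩

end TrivialisedPresentation

end GaloisStructure

section Reflections

theorem nonempty_reflective_of_isUniversal {Y Z : Type*} [Category* Y] [Category* Z] (R : Z ⥤ Y)
    [R.Full] [R.Faithful] (h : ∀ A : Y, ∃ u : StructuredArrow A R, Nonempty u.IsUniversal) :
    Nonempty (Reflective R) := by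
  have : R.IsRightAdjoint := isRightAdjoint_iff_hasInitial_structuredArrow.2 fun A =>
    have ⟨_, ⟨hu⟩⟩ := h A
    hu.hasInitial
  exact ⟨{ L := R.leftAdjoint, adj := Adjunction.ofIsRightAdjoint R }⟩

theorem GaloisStructure.exists_iso_comp_eq_η {Y : Type w} [Category.{w'} Y]
    {E : MorphismProperty Y} (Γ : GaloisStructure E) {X : ObjectProperty Y} (hX : Γ.X = X) {A : Y}
    {u : StructuredArrow A X.ι} (hu : u.IsUniversal) :
    ∃ e : u.right.obj ≅ Γ.refl A, u.hom ≫ e.hom = Γ.η A := by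
  subst hX
  let e := hu.uniqueUpToIso (mkInitialOfLeftAdjoint Γ.X.ι Γ.adj A)
  exact ⟨Γ.X.ι.mapIso ((StructuredArrow.proj A Γ.X.ι).mapIso e), StructuredArrow.w e.hom⟩

end Reflections

section Levels

variable {C : Type (max u v)} [Category.{v} C] {n : ℕ}

namespace Level

/-- An extension in `Cₙ`, seen as an object of `Cₙ₊₁`. -/
def ofHom {A B : Level.{v, u} C n} (g : A ⟶ B) (hg : levelExt.{v, u} C n g) :
    Level.{v, u} C (n + 1) :=
  ⟨Arrow.mk g.hom, hg⟩

/-- A commutative square in `Cₙ`, seen as a morphism of `Cₙ₊₁`. -/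
def homMk {F G : Level.{v, u} C (n + 1)} (t : F.dom ⟶ G.dom) (b : F.cod ⟶ G.cod)
    (w : t ≫ G.toHom = F.toHom ≫ b) : F ⟶ G :=
  ObjectProperty.homMk (Arrow.homMk (f := F.toArrow) (g := G.toArrow) t.hom b.hom
    (congrArg (isExt.{v, u} C n).ι.map w))

/-- The top side of a morphism of `Cₙ₊₁`, seen as a commutative square in `Cₙ`. -/
def left {F G : Level.{v, u} C (n + 1)} (φ : F ⟶ G) : F.dom ⟶ G.dom :=
  ObjectProperty.homMk ((show F.toArrow ⟶ G.toArrow from φ.hom).left)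

/-- The bottom side of a morphism of `Cₙ₊₁`, seen as a commutative square in `Cₙ`. -/
def right {F G : Level.{v, u} C (n + 1)} (φ : F ⟶ G) : F.cod ⟶ G.cod :=
  ObjectProperty.homMk ((show F.toArrow ⟶ G.toArrow from φ.hom).right)

theorem left_toHom {F G : Level.{v, u} C (n + 1)} (φ : F ⟶ G) :
    left φ ≫ G.toHom = F.toHom ≫ right φ :=
  (isExt.{v, u} C n).ι.map_injective (Arrow.w (f := F.toArrow) (g := G.toArrow) φ.hom)

theorem hom_ext {F G : Level.{v, u} C (n + 1)} {φ ψ : F ⟶ G} (hl : left φ = left ψ)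
    (hr : right φ = right ψ) : φ = ψ :=
  (isExt.{v, u} C (n + 1)).ι.map_injective (Arrow.hom_ext
    (show F.toArrow ⟶ G.toArrow from φ.hom) (show F.toArrow ⟶ G.toArrow from ψ.hom)
    (congrArg (isExt.{v, u} C n).ι.map hl)
    (congrArg (isExt.{v, u} C n).ι.map hr))

end Level

namespace GaloisStructure.IsCoveringReflection

variable {Γ : GaloisStructure (levelExt.{v, u} C n)} {F : Level.{v, u} C (n + 1)}
  {A' : Level.{v, u} C n} {h : F.dom ⟶ A'} {g : A' ⟶ F.cod}

/-- A covering reflection `(h, 𝟙)` of an extension `F` of `Cₙ`, seen as a morphism of `Cₙ₊₁` from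
`F` to a covering. -/
def toStructuredArrow (H : Γ.IsCoveringReflection F.toHom h g) : StructuredArrow F (Cov Γ).ι :=
  let G : (Cov Γ).FullSubcategory := ⟨Level.ofHom g H.covering.1, H.covering⟩
  StructuredArrow.mk (Y := G)
    (Level.homMk (G := G.obj) h (𝟙 F.cod) (H.fac.trans (Category.comp_id F.toHom).symm))

theorem existsUnique_toStructuredArrow_hom_comp (H : Γ.IsCoveringReflection F.toHom h g)
    {G : Level.{v, u} C (n + 1)} (hG : Cov Γ G) (φ : F ⟶ G) :
    ∃! ψ : H.toStructuredArrow.right.obj ⟶ G, H.toStructuredArrow.hom ≫ ψ = φ := by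
  obtain ⟨x, ⟨hx₁, hx₂⟩, hx⟩ :=
    H.universal G.toHom hG (Level.left φ) (Level.right φ) (Level.left_toHom φ)
  refine ⟨Level.homMk (F := Level.ofHom g H.covering.1) x (Level.right (F := F) φ) hx₂,
    Level.hom_ext hx₁ (Category.id_comp (Level.right φ)), fun ψ hψ => ?_⟩
  have hr : Level.right ψ = Level.right φ :=
    (Category.id_comp (Level.right ψ)).symm.trans (congrArg Level.right hψ)
  exact Level.hom_ext (hx _ ⟨congrArg Level.left hψ, hr ▸ Level.left_toHom ψ⟩) hr

theorem nonempty_isUniversal (H : Γ.IsCoveringReflection F.toHom h g) :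
    Nonempty H.toStructuredArrow.IsUniversal := by
  choose ψ hψ hψ' using fun G : StructuredArrow F (Cov Γ).ι =>
    H.existsUnique_toStructuredArrow_hom_comp G.right.property G.hom
  exact ⟨IsInitial.ofUniqueHom
    (fun G => StructuredArrow.homMk (ObjectProperty.homMk (ψ G)) (hψ G)) fun G m =>
      StructuredArrow.hom_ext _ _ (ObjectProperty.hom_ext _ (hψ' G _ (StructuredArrow.w m)))⟩

end GaloisStructure.IsCoveringReflection

variable (C) [Regular C] [EnoughRegularProjectives C]

instance isExtensionClass_levelExt (n : ℕ) : IsExtensionClass (levelExt.{v, u} C n) ⊤ :=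
  inferInstanceAs (IsExtensionClass ((ext.{v, u} C n).inverseImage (isExt.{v, u} C n).ι) ⊤)

instance hasPullbacks_levelExt (n : ℕ) : (levelExt.{v, u} C n).HasPullbacks :=
  inferInstanceAs ((ext.{v, u} C n).inverseImage (isExt.{v, u} C n).ι).HasPullbacks

variable [HasReflexiveCoequalizers C]

instance isCornerClass_level (n : ℕ) :
    IsCornerClass ((corner.{v, u} C n).inverseImage (isExt.{v, u} C n).ι) (levelExt.{v, u} C n) :=
  inferInstanceAs (IsCornerClass _ ((ext.{v, u} C n).inverseImage (isExt.{v, u} C n).ι))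

variable {C}

theorem GaloisTower.corner_η (T : GaloisTower.{v, u} C n) :
    ∀ (k : ℕ) (hk : k ≤ n) (A : Level.{v, u} C k),
      (corner.{v, u} C k).inverseImage (isExt.{v, u} C k).ι ((T.Γ k hk).η A)
  | 0, _, _ => trivial
  | k + 1, hk, A => by
    have hΓ := T.stronglyBirkhoff k (Nat.le_of_succ_le hk)
    obtain ⟨D⟩ := GaloisStructure.exists_trivialisedPresentation hΓ (f := A.toHom) A.property
    obtain ⟨A', r, h, g, -, -, -, -, H, hh⟩ :=
      D.exists_isCoveringReflection hΓ (T.corner_η k (Nat.le_of_succ_le hk)) A.property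
    obtain ⟨hu⟩ := H.nonempty_isUniversal
    obtain ⟨e, he⟩ := (T.Γ (k + 1) hk).exists_iso_comp_eq_η (T.eq_cov k hk) hu
    rw [← he]
    exact (MorphismProperty.cancel_right_of_respectsIso _ _ e.hom).2
      ⟨hh, inferInstanceAs (IsIso (𝟙 A.toArrow.right))⟩

end Levels

end HigherCoverings

open HigherCoverings in
theorem mainTheorem6_general {C : Type (max u v)} [Category.{v} C] [Regular C]
    [HasReflexiveCoequalizers C] [EnoughRegularProjectives C]
    (n : ℕ) (T : GaloisTower.{v, u} C n) :
    Nonempty (Reflective (Cov T.last).ι) ∧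
    ∀ ⦃A B : Level.{v, u} C n⦄ (f : A ⟶ B), levelExt.{v, u} C n f →
      Nonempty (T.last.TrivialisedPresentation f) ∧
      ∀ D : T.last.TrivialisedPresentation f,
        ∃ (A' : Level.{v, u} C n) (r : D.trivX.obj ⟶ A') (h : A ⟶ A') (g : A' ⟶ B)
          (hr : D.π₁ ≫ r = D.π₂ ≫ r),
          Nonempty (IsColimit (Cofork.ofπ r hr)) ∧
          D.trivX.τ ≫ r = D.πA ≫ h ∧
          r ≫ g = D.trivX.map ≫ D.p ∧
          T.last.IsCoveringReflection f h g := by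
  have hΓ := T.stronglyBirkhoff n le_rfl
  have hη := T.corner_η n le_rfl
  refine ⟨nonempty_reflective_of_isUniversal _ fun F => ?_, fun A B f hf =>
    ⟨GaloisStructure.exists_trivialisedPresentation hΓ hf, fun D => ?_⟩⟩
  · obtain ⟨D⟩ := GaloisStructure.exists_trivialisedPresentation hΓ (f := F.toHom) F.property
    obtain ⟨A', r, h, g, -, -, -, -, H, -⟩ := D.exists_isCoveringReflection hΓ hη F.property
    exact ⟨_, H.nonempty_isUniversal⟩
  · obtain ⟨A', r, h, g, hr, hcolim, hτ, hg, H, -⟩ := D.exists_isCoveringReflection hΓ hη hf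
    exact ⟨A', r, h, g, hr, hcolim, hτ, hg, H⟩

theorem mainTheorem6 {C : Type (max u v)} [Category.{v} C] [HigherCoverings.BarrExact C]
    [HasReflexiveCoequalizers C] [HigherCoverings.EnoughRegularProjectives C]
    (n : ℕ) (T : HigherCoverings.GaloisTower.{v, u} C n) :
    Nonempty (Reflective (HigherCoverings.Cov T.last).ι) ∧
    ∀ ⦃A B : HigherCoverings.Level.{v, u} C n⦄ (f : A ⟶ B), HigherCoverings.levelExt.{v, u} C n f →
      Nonempty (T.last.TrivialisedPresentation f) ∧
      ∀ D : T.last.TrivialisedPresentation f,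
        ∃ (A' : HigherCoverings.Level.{v, u} C n) (r : D.trivX.obj ⟶ A') (h : A ⟶ A') (g : A' ⟶ B)
          (hr : D.π₁ ≫ r = D.π₂ ≫ r),
          Nonempty (IsColimit (Cofork.ofπ r hr)) ∧
          D.trivX.τ ≫ r = D.πA ≫ h ∧
          r ≫ g = D.trivX.map ≫ D.p ∧
          T.last.IsCoveringReflection f h g :=
  mainTheorem6_general n T
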